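/- Let $T,d\in\mathbb{N}$, let $(\Omega,\mathcal{F},P)$ be a probability space and let $(\mathcal{F}_t)_{t=0,\dots,T}$ be a filtration on it such that $\mathcal{F}_0$ is the trivial $\sigma$-field completed by the $P$-null sets of $\mathcal{F}$. There is a riskless asset with constant price $1$, and there are $d$ risky assets whose discounted prices form an adapted $\mathbb{R}^d$-valued process $(S_t)_{t=0,\dots,T}$ with $S^i_t=S^i_{t-1}(1+R^i_t)$ for $t=1,\dots,T$ and $i=1,\dots,d$, where $R_t=(R^1_t,\dots,R^d_t)$ is $\mathcal{F}_t$-measurable and $R^i_t\ge -1$ a.s. For $t=1,\dots,T$ let $\mathcal{S}_t$ be the $\mathcal{F}_{t-1}$-conditional support of $R_t$ (the support of a regular version of the $\mathcal{F}_{t-1}$-conditional distribution of $R_t$), let $\mathcal{L}_t$ be the smallest linear subspace of $\mathbb{R}^d$ containing $\mathcal{S}_t$, and let $\mathcal{L}_t^\perp$ be its orthogonal complement. Trading constraints are given by random sets $\Theta_{\mathrm{c},t}$, $t=1,\dots,T$, such that each $\Theta_{\mathrm{c},t}(\omega)\subseteq\mathbb{R}^d$ is closed and convex, $\Theta_{\mathrm{c},t}$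 is $\mathcal{F}_{t-1}$-measurable (that is, $\{\omega:\Theta_{\mathrm{c},t}(\omega)\cap G\ne\emptyset\}\in\mathcal{F}_{t-1}$ for every open $G\subseteq\mathbb{R}^d$), and $\mathcal{L}_t^\perp\subseteq\Theta_{\mathrm{c},t}$ a.s. Let $$\Theta_{\mathrm{adm},t}=\{\pi\in\mathbb{R}^d:\langle\pi,z\rangle\ge-1\text{ for all }z\in\mathcal{S}_t\},\qquad \Theta_t=\Theta_{\mathrm{adm},t}\cap\Theta_{\mathrm{c},t}.$$ An allowed strategy is a process $\pi=(\pi_t)_{t=1,\dots,T}$ such that, for every $t$, $\pi_t$ is an $\mathcal{F}_{t-1}$-measurable $\mathbb{R}^d$-valued random vector and $\pi_t\in\Theta_t$ a.s.; we then write $\pi\in\Theta$. Its wealth from the initial capital $v>0$ is $V^\pi_t(v)=v\prod_{k=1}^t(1+\langle\pi_k,R_k\rangle)$ for $t=0,\dots,T$, and $V^\pi:=V^\pi(1)$. The condition NA$_1$ (no arbitrage of the first kind) says that every nonnegative $\mathcal{F}_T$-measurable random variable $\xi$ with $v(\xi)=0$ satisfies $\xi=0$ a.s., where $$v(\xi)=\inf\{v>0:\exists\,\pi\in\Theta\text{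 such that }V^\pi_T(v)\ge\xi\text{ a.s.}\}\qquad(\inf\emptyset=+\infty).$$ A supermartingale deflator is an adapted process $Z=(Z_t)_{t=0,\dots,T}$ with $Z_0=1$, with $Z_t>0$ a.s. for all $t$, and such that $ZV^\pi$ is a supermartingale for every $\pi\in\Theta$. A numéraire portfolio is an allowed strategy $\rho\in\Theta$ such that $1/V^\rho$ is a supermartingale deflator; in particular $V^\rho_t>0$ a.s. for all $t$, and $V^\pi/V^\rho$ is a supermartingale for every $\pi\in\Theta$. Theorem. The following are equivalent: 1. NA$_1$ holds; 2. there exists a supermartingale deflator; 3. there exists a numéraire portfolio. -/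

import Mathlib

open MeasureTheory ProbabilityTheory
open scoped ENNReal InnerProductSpace

noncomputable section

/-- The `m`-conditional support of a random vector `X`: the topological support of the regular
`m`-conditional distribution of `X` under `P` at `ω`. The kernel `condDistrib X id P`, where `id`
is regarded as a map from `Ω` to `(Ω, m)`, is a regular version of the conditional distribution
of `X` given `m`. -/
def condSupport {Ω : Type*} (m : MeasurableSpace Ω) [mΩ : MeasurableSpace Ω] (P : Measure Ω)
    [IsProbabilityMeasure P] {d : ℕ} (X : Ω → EuclideanSpace ℝ (Fin d)) (ω : Ω) :
    Set (EuclideanSpace ℝ (Fin d)) :=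
  (@condDistrib Ω Ω (EuclideanSpace ℝ (Fin d)) _ _ _ mΩ m X id P _ ω).support

/-- The smallest linear subspace containing the conditional support. -/
def condSpan {Ω : Type*} (m : MeasurableSpace Ω) [mΩ : MeasurableSpace Ω] (P : Measure Ω)
    [IsProbabilityMeasure P] {d : ℕ} (X : Ω → EuclideanSpace ℝ (Fin d)) (ω : Ω) :
    Submodule ℝ (EuclideanSpace ℝ (Fin d)) :=
  Submodule.span ℝ (condSupport m P X ω)

/-- Measurability of a correspondence `A` from `(Ω, m)` to `ℝ^d`: for every open `G`, the set of
those `ω` for which `A ω` meets `G` is in `m`. -/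
def MeasurableCorrespondence {Ω : Type*} (m : MeasurableSpace Ω) {d : ℕ}
    (A : Ω → Set (EuclideanSpace ℝ (Fin d))) : Prop :=
  ∀ G : Set (EuclideanSpace ℝ (Fin d)), IsOpen G → MeasurableSet[m] {ω | (A ω ∩ G).Nonempty}

/-- A market with dates `0, …, T`, one riskless asset of constant price one and `d` risky assets,
under random closed convex trading constraints. Dates are elements of `Fin (T + 1)`. Periods are
elements of `Fin T`: the period `k` runs from the date `k.castSucc` to the date `k.succ`, so that
what is usually written `R_t`, `π_t`, `Θ_t` (for `t = 1, …, T`) has the index `k = t - 1`. -/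
structure MarketModel {Ω : Type*} [mΩ : MeasurableSpace Ω] (P : Measure Ω)
    [IsProbabilityMeasure P] (T d : ℕ) where
  /-- the information filtration -/
  F : Filtration (Fin (T + 1)) mΩ
  /-- the initial `σ`-field is the trivial one completed by the null sets -/
  F_zero : ∀ A : Set Ω, MeasurableSet[F 0] A ↔ MeasurableSet A ∧ (P A = 0 ∨ P A = 1)
  /-- discounted prices of the risky assets -/
  S : Fin (T + 1) → Ω → EuclideanSpace ℝ (Fin d)
  S_adapted : ∀ t, Measurable[F t] (S t)
  /-- returns of the risky assets -/
  R : Fin T → Ω → EuclideanSpace ℝ (Fin d)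
  R_measurable : ∀ k, Measurable[F k.succ] (R k)
  R_ge : ∀ k i, ∀ᵐ ω ∂P, -1 ≤ R k ω i
  S_eq : ∀ k i, ∀ᵐ ω ∂P, S k.succ ω i = S k.castSucc ω i * (1 + R k ω i)
  /-- trading constraints -/
  Θc : Fin T → Ω → Set (EuclideanSpace ℝ (Fin d))
  Θc_predictable : ∀ k, MeasurableCorrespondence (F k.castSucc) (Θc k)
  Θc_closed : ∀ k ω, IsClosed (Θc k ω)
  Θc_convex : ∀ k ω, Convex ℝ (Θc k ω)
  /-- Degenerate strategies, with almost surely vanishing return, are permitted. The inclusion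
  holds up to a null set, since a regular conditional distribution is determined only up to one. -/
  orthogonal_subset : ∀ k, ∀ᵐ ω ∂P,
    ((condSpan (F k.castSucc) P (R k) ω)ᗮ : Set (EuclideanSpace ℝ (Fin d))) ⊆ Θc k ω

namespace MarketModel

variable {Ω : Type*} [mΩ : MeasurableSpace Ω] {P : Measure Ω} [IsProbabilityMeasure P]
  {T d : ℕ} (M : MarketModel P T d)

/-- The natural constraints. -/
def Θadm (k : Fin T) (ω : Ω) : Set (EuclideanSpace ℝ (Fin d)) :=
  {x | ∀ z ∈ condSupport (M.F k.castSucc) P (M.R k) ω, -1 ≤ ⟪x, z⟫_ℝ}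

/-- The random set of allowed positions. -/
def Θ (k : Fin T) (ω : Ω) : Set (EuclideanSpace ℝ (Fin d)) := M.Θadm k ω ∩ M.Θc k ω

/-- `π` is an allowed strategy: predictable, and almost surely in `Θ` in each period. -/
def Allowed (π : Fin T → Ω → EuclideanSpace ℝ (Fin d)) : Prop :=
  ∀ k, Measurable[M.F k.castSucc] (π k) ∧ ∀ᵐ ω ∂P, π k ω ∈ M.Θ k ω

/-- Wealth at the date `t` of the strategy `π` started from the capital `v`: the product runs over
the periods that end no later than `t`. -/
def wealth (v : ℝ) (π : Fin T → Ω → EuclideanSpace ℝ (Fin d)) (t : Fin (T + 1)) (ω : Ω) : ℝ :=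
  v * ∏ k : Fin T with k.succ ≤ t, (1 + ⟪π k ω, M.R k ω⟫_ℝ)

/-- The super-hedging value of `ξ`, equal to `∞` if no initial capital suffices. -/
def superhedgeValue (ξ : Ω → ℝ) : ℝ≥0∞ :=
  sInf {x | ∃ v : ℝ, 0 < v ∧ x = ENNReal.ofReal v ∧
    ∃ π, M.Allowed π ∧ ∀ᵐ ω ∂P, ξ ω ≤ M.wealth v π (Fin.last T) ω}

/-- No arbitrage of the first kind. -/
def NA1 : Prop :=
  ∀ ξ : Ω → ℝ, Measurable[M.F (Fin.last T)] ξ → (∀ᵐ ω ∂P, 0 ≤ ξ ω) →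
    M.superhedgeValue ξ = 0 → ∀ᵐ ω ∂P, ξ ω = 0

/-- `Z` is a supermartingale deflator. -/
structure IsDeflator (Z : Fin (T + 1) → Ω → ℝ) : Prop where
  adapted : ∀ t, Measurable[M.F t] (Z t)
  pos : ∀ t, ∀ᵐ ω ∂P, 0 < Z t ω
  zero_eq : ∀ᵐ ω ∂P, Z 0 ω = 1
  supermartingale : ∀ π, M.Allowed π →
    Supermartingale (fun t ω => Z t ω * M.wealth 1 π t ω) M.F P

/-- The set of all supermartingale deflators. -/
def deflators : Set (Fin (T + 1) → Ω → ℝ) := {Z | M.IsDeflator Z}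

/-- `ρ` is a numéraire portfolio: it is allowed, and the reciprocal of its wealth process is a
supermartingale deflator (in particular, its wealth is almost surely positive). -/
def IsNumeraire (ρ : Fin T → Ω → EuclideanSpace ℝ (Fin d)) : Prop :=
  M.Allowed ρ ∧ (fun t ω => 1 / M.wealth 1 ρ t ω) ∈ M.deflators

end MarketModel

end

/-! A deflator excludes arbitrage by pricing: if the capital v super-hedges ξ, then E[Z_T ξ] ≤ v, so
v(ξ) = 0 forces Z_T ξ = 0 (`IsDeflator.na1`). A numéraire portfolio provides a deflator by
definition. The work lies in getting a numéraire portfolio from `NA1`.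

Trading in one period only is allowed, so `NA1` passes to each period (`NA1.isViable`): a direction
all of whose multiples are allowed has zero return, since its return could otherwise be bought from
arbitrarily small capital. In one period the numéraire should maximise expected logarithmic utility,
which may be infinite. For the bounded substitute `boundedLog e`, an e²-maximiser satisfies the
first order condition of the logarithm up to an error of order e, on every event known at the start
of the period (`exists_approx_maximizer`). Projecting away directions of zero return does not change
wealth, and afterwards the maximisers cannot escape to infinity: a limiting direction would have
zero return, hence be orthogonal to itself. So they converge along a random subsequence, and Fatou's
lemma yields E[(1 + ⟨π, R⟩)/(1 + ⟨ρ, R⟩)] ≤ 1 (`IsViable.exists_numeraire`).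

Pasting π on an event with ρ off it makes this bound conditional. Then V^π/V^ρ is a product of
factors of conditional expectation at most one, hence a supermartingale
(`isNumeraire_of_forall_period`). -/

noncomputable section

open Filter Topology

/-! ### Measurable random subsequences -/

/-- Evaluation of a sequence of measurable functions at a measurable random index. -/
lemma measurable_comp_randomIndex {Ω β : Type*} {m : MeasurableSpace Ω} [MeasurableSpace β]
    {x : ℕ → Ω → β} (hx : ∀ n, Measurable (x n)) {τ : Ω → ℕ} (hτ : Measurable τ) :
    Measurable fun ω => x (τ ω) ω := by
  have h : Measurable (fun p : ℕ × Ω => x p.1 p.2) := measurable_from_prod_countable_right hx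
  exact h.comp (hτ.prodMk measurable_id)

/-- A bounded sequence of random variables has a measurable random subsequence that converges
to its upper limit. -/
lemma exists_randomIndex_tendsto_real {Ω : Type*} {m : MeasurableSpace Ω} {C : ℝ}
    {x : ℕ → Ω → ℝ} (hx : ∀ n, Measurable (x n)) (hb : ∀ n ω, |x n ω| ≤ C) :
    ∃ τ : ℕ → Ω → ℕ, (∀ k, Measurable (τ k)) ∧ (∀ k ω, k ≤ τ k ω) ∧
      ∃ l : Ω → ℝ, Measurable l ∧ ∀ ω, Tendsto (fun k => x (τ k ω) ω) atTop (𝓝 (l ω)) := by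
  classical
  let l : Ω → ℝ := fun ω => limsup (fun n => x n ω) atTop
  have hl : Measurable l := Measurable.limsup hx
  have hex : ∀ (k : ℕ) (ω : Ω), ∃ n, k ≤ n ∧ |x n ω - l ω| < 1 / ((k : ℝ) + 1) := by
    intro k ω
    have hpos : (0 : ℝ) < 1 / ((k : ℝ) + 1) := by positivity
    have hup : IsBoundedUnder (· ≤ ·) atTop (fun n => x n ω) :=
      isBoundedUnder_of ⟨C, fun n => (abs_le.1 (hb n ω)).2⟩
    have hlo : IsBoundedUnder (· ≥ ·) atTop (fun n => x n ω) :=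
      isBoundedUnder_of ⟨-C, fun n => (abs_le.1 (hb n ω)).1⟩
    have h1 : ∀ᶠ n in atTop, x n ω < l ω + 1 / ((k : ℝ) + 1) :=
      eventually_lt_of_limsup_lt (by change l ω < _; linarith) hup
    have h2 : ∃ᶠ n in atTop, l ω - 1 / ((k : ℝ) + 1) < x n ω :=
      frequently_lt_of_lt_limsup hlo.isCoboundedUnder_le (by change _ < l ω; linarith)
    obtain ⟨n, hn, hn1, hn2⟩ := (h2.and_eventually (h1.and (eventually_ge_atTop k))).exists
    exact ⟨n, hn2, by rw [abs_lt]; constructor <;> linarith⟩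
  -- The indices need not increase in k: `k ≤ τ k ω` makes them tend to infinity, which is all that
  -- the later passages to the limit need.
  refine ⟨fun k ω => Nat.find (hex k ω), fun k => ?_, fun k ω => (Nat.find_spec (hex k ω)).1,
    l, hl, fun ω => ?_⟩
  · refine measurable_find _ fun n => ?_
    exact (MeasurableSet.const _).inter
      (measurableSet_lt (continuous_abs.measurable.comp ((hx n).sub hl)) measurable_const)
  · rw [tendsto_iff_dist_tendsto_zero]
    refine squeeze_zero (fun _ => dist_nonneg) (fun k => ?_) tendsto_one_div_add_atTop_nhds_zero_nat
    rw [Real.dist_eq]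
    exact (Nat.find_spec (hex k ω)).2.le

/-- Finitely many bounded sequences of random variables converge along a common measurable random
subsequence. -/
lemma exists_randomIndex_tendsto {Ω ι : Type*} [Finite ι] {m : MeasurableSpace Ω} {C : ℝ}
    {x : ι → ℕ → Ω → ℝ} (hx : ∀ i n, Measurable (x i n)) (hb : ∀ i n ω, |x i n ω| ≤ C) :
    ∃ τ : ℕ → Ω → ℕ, (∀ k, Measurable (τ k)) ∧ (∀ k ω, k ≤ τ k ω) ∧
      ∃ l : ι → Ω → ℝ, (∀ i, Measurable (l i)) ∧
        ∀ i ω, Tendsto (fun k => x i (τ k ω) ω) atTop (𝓝 (l i ω)) := by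
  classical
  cases nonempty_fintype ι
  suffices H : ∀ s : Finset ι, ∃ τ : ℕ → Ω → ℕ, (∀ k, Measurable (τ k)) ∧ (∀ k ω, k ≤ τ k ω) ∧
      ∃ l : ι → Ω → ℝ, (∀ i, Measurable (l i)) ∧
        ∀ i ∈ s, ∀ ω, Tendsto (fun k => x i (τ k ω) ω) atTop (𝓝 (l i ω)) by
    obtain ⟨τ, h1, h2, l, h3, h4⟩ := H Finset.univ
    exact ⟨τ, h1, h2, l, h3, fun i => h4 i (Finset.mem_univ i)⟩
  intro s
  induction s using Finset.induction_on with
  | empty =>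
    exact ⟨fun k _ => k, fun k => measurable_const, fun k _ => le_rfl, fun _ _ => 0,
      fun _ => measurable_const, by simp⟩
  | insert j s hj ih =>
    obtain ⟨τ, h1, h2, l, h3, h4⟩ := ih
    obtain ⟨σ, g1, g2, l', g3, g4⟩ := exists_randomIndex_tendsto_real (C := C)
      (x := fun k ω => x j (τ k ω) ω) (fun k => measurable_comp_randomIndex (hx j) (h1 k))
      (fun k ω => hb _ _ _)
    refine ⟨fun k ω => τ (σ k ω) ω, fun k => measurable_comp_randomIndex h1 (g1 k),
      fun k ω => (g2 k ω).trans (h2 _ ω), Function.update l j l', fun i => ?_, fun i hi ω => ?_⟩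
    · rcases eq_or_ne i j with rfl | h
      · simpa using g3
      · simpa [h] using h3 i
    · rcases eq_or_ne i j with rfl | h
      · simpa using g4 ω
      · have hσ : Tendsto (fun k => σ k ω) atTop atTop :=
          tendsto_atTop_mono (fun k => g2 k ω) tendsto_id
        rw [Function.update_of_ne h]
        exact (h4 i (Finset.mem_of_mem_insert_of_ne hi h) ω).comp hσ

/-- Bounded sequences of random vectors and of random variables converge along a common measurable
random subsequence. -/
lemma exists_randomIndex_tendsto_euclidean {Ω : Type*} {m : MeasurableSpace Ω} {d : ℕ} {C : ℝ}
    {w : ℕ → Ω → EuclideanSpace ℝ (Fin d)} {c : ℕ → Ω → ℝ} (hw : ∀ n, Measurable (w n))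
    (hc : ∀ n, Measurable (c n)) (hwb : ∀ n ω, ‖w n ω‖ ≤ C) (hcb : ∀ n ω, |c n ω| ≤ C) :
    ∃ τ : ℕ → Ω → ℕ, (∀ k, Measurable (τ k)) ∧ (∀ k ω, k ≤ τ k ω) ∧
      ∃ (w' : Ω → EuclideanSpace ℝ (Fin d)) (c' : Ω → ℝ), Measurable w' ∧ Measurable c' ∧
        ∀ ω, Tendsto (fun k => w (τ k ω) ω) atTop (𝓝 (w' ω)) ∧
          Tendsto (fun k => c (τ k ω) ω) atTop (𝓝 (c' ω)) := by
  obtain ⟨τ, h1, h2, l, h3, h4⟩ := exists_randomIndex_tendsto (ι := Option (Fin d)) (C := C)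
    (x := fun i n ω => i.elim (c n ω) (fun j => w n ω j))
    (by
      rintro (_ | j) n
      · exact hc n
      · exact (EuclideanSpace.proj (𝕜 := ℝ) j).continuous.measurable.comp (hw n))
    (by
      rintro (_ | j) n ω
      · exact hcb n ω
      · exact (PiLp.norm_apply_le (w n ω) j).trans (hwb n ω))
  refine ⟨τ, h1, h2, fun ω => WithLp.toLp 2 fun j => l (some j) ω, l none, ?_, h3 none,
    fun ω => ⟨?_, h4 none ω⟩⟩
  · exact (PiLp.continuous_toLp 2 _).measurable.comp (measurable_pi_lambda _ fun j => h3 (some j))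
  · have h : Tendsto (fun k => fun j => w (τ k ω) ω j) atTop (𝓝 fun j => l (some j) ω) :=
      tendsto_pi_nhds.2 fun j => h4 (some j) ω
    exact ((PiLp.continuous_toLp 2 (fun _ : Fin d => ℝ)).tendsto _).comp h

/-! ### Removing the redundant part of a position -/

/-- The square integrable `G`-measurable random vectors that are almost surely orthogonal
to `R`. -/
def annihilatorLp {Ω : Type*} (G : MeasurableSpace Ω) [mΩ : MeasurableSpace Ω] (P : Measure Ω)
    {d : ℕ} (R : Ω → EuclideanSpace ℝ (Fin d)) :
    Submodule ℝ (Lp (EuclideanSpace ℝ (Fin d)) 2 P) where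
  carrier := {f | AEStronglyMeasurable[G] f P ∧ ∀ᵐ ω ∂P, ⟪f ω, R ω⟫_ℝ = 0}
  zero_mem' := by
    refine ⟨(lpMeas (EuclideanSpace ℝ (Fin d)) ℝ G 2 P).zero_mem, ?_⟩
    filter_upwards [Lp.coeFn_zero (EuclideanSpace ℝ (Fin d)) 2 P] with ω h
    rw [h, Pi.zero_apply, inner_zero_left]
  add_mem' := by
    rintro f g ⟨hf, hf'⟩ ⟨hg, hg'⟩
    refine ⟨(lpMeas (EuclideanSpace ℝ (Fin d)) ℝ G 2 P).add_mem hf hg, ?_⟩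
    filter_upwards [Lp.coeFn_add f g, hf', hg'] with ω h h1 h2
    rw [h, Pi.add_apply, inner_add_left, h1, h2, add_zero]
  smul_mem' := by
    rintro c f ⟨hf, hf'⟩
    refine ⟨(lpMeas (EuclideanSpace ℝ (Fin d)) ℝ G 2 P).smul_mem c hf, ?_⟩
    filter_upwards [Lp.coeFn_smul c f, hf'] with ω h h1
    simp [h, inner_smul_left, h1]

/-- An L² limit is an almost sure limit along a subsequence, so orthogonality to R survives.
Closedness gives the completeness behind the orthogonal projection. -/
lemma isClosed_annihilatorLp {Ω : Type*} {G mΩ : MeasurableSpace Ω} (hG : G ≤ mΩ) (P : Measure Ω)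
    {d : ℕ} (R : Ω → EuclideanSpace ℝ (Fin d)) :
    IsClosed (annihilatorLp G P R : Set (Lp (EuclideanSpace ℝ (Fin d)) 2 P)) := by
  refine IsSeqClosed.isClosed fun f g hf hfg => ⟨?_, ?_⟩
  · exact (isClosed_aestronglyMeasurable hG).mem_of_tendsto hfg
      (Eventually.of_forall fun n => (hf n).1)
  · obtain ⟨s, -, hs⟩ := (tendstoInMeasure_of_tendsto_Lp hfg).exists_seq_tendsto_ae
    filter_upwards [hs, ae_all_iff.2 fun n => (hf n).2] with ω h1 h2
    have h3 : Tendsto (fun i => ⟪(f (s i)) ω, R ω⟫_ℝ) atTop (𝓝 ⟪g ω, R ω⟫_ℝ) :=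
      h1.inner tendsto_const_nhds
    simp only [h2] at h3
    exact tendsto_nhds_unique h3 tendsto_const_nhds

/-- Orthogonal decomposition of a bounded `G`-measurable random vector along the `G`-measurable
random vectors that are orthogonal to `R`. -/
lemma exists_orthogonal_part_of_bounded {Ω : Type*} {G mΩ : MeasurableSpace Ω} (hG : G ≤ mΩ)
    {P : Measure Ω} [IsProbabilityMeasure P] {d : ℕ} {R : Ω → EuclideanSpace ℝ (Fin d)}
    {π : Ω → EuclideanSpace ℝ (Fin d)} (hπ : Measurable[G] π) (hb : ∀ ω, ‖π ω‖ ≤ 1) :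
    ∃ v : Ω → EuclideanSpace ℝ (Fin d), Measurable[G] v ∧
      (∀ᵐ ω ∂P, ⟪π ω - v ω, R ω⟫_ℝ = 0) ∧
      ∀ ζ : Ω → EuclideanSpace ℝ (Fin d), Measurable[G] ζ → (∀ᵐ ω ∂P, ⟪ζ ω, R ω⟫_ℝ = 0) →
        ∀ᵐ ω ∂P, ⟪v ω, ζ ω⟫_ℝ = 0 := by
  have hmem : ∀ {u : Ω → EuclideanSpace ℝ (Fin d)}, Measurable[G] u → (∀ ω, ‖u ω‖ ≤ 1) →
      MemLp u 2 P := fun hu hb =>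
    MemLp.of_bound (hu.mono hG le_rfl).aestronglyMeasurable 1 (Eventually.of_forall hb)
  set N := annihilatorLp G P R
  have : CompleteSpace N := (isClosed_annihilatorLp hG P R).completeSpace_coe
  set f : Lp (EuclideanSpace ℝ (Fin d)) 2 P := (hmem hπ hb).toLp π
  set η := N.starProjection f
  have hη : η ∈ N := N.starProjection_apply_mem f
  have hfη : f - η ∈ Nᗮ := N.sub_starProjection_mem_orthogonal f
  obtain ⟨η', hη'm, hη'⟩ := hη.1
  have hf : ∀ᵐ ω ∂P, f ω = π ω := (hmem hπ hb).coeFn_toLp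
  refine ⟨fun ω => π ω - η' ω, hπ.sub hη'm.measurable, ?_, fun ζ hζ hζR => ?_⟩
  · filter_upwards [hη.2, hη'] with ω h1 h2
    simp [← h2, h1]
  · set v : Ω → EuclideanSpace ℝ (Fin d) := fun ω => π ω - η' ω
    have hv : Measurable[G] v := hπ.sub hη'm.measurable
    -- Testing f - η against u = a⟨v, ζ⟩ζ gives E[a⟨v, ζ⟩²] = 0, which turns orthogonality in L²
    -- into pointwise orthogonality. The factor a > 0 keeps u bounded, since ζ need not be square
    -- integrable.
    set a : Ω → ℝ := fun ω => ((1 + ‖v ω‖ * ‖ζ ω‖) * (1 + ‖ζ ω‖))⁻¹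
    have ha : Measurable[G] a :=
      ((measurable_const.add ((measurable_norm.comp hv).mul (measurable_norm.comp hζ))).mul
        (measurable_const.add (measurable_norm.comp hζ))).inv
    have hin : Measurable[G] fun ω => ⟪v ω, ζ ω⟫_ℝ := hv.inner hζ
    have ha0 : ∀ ω, 0 < a ω := fun ω => by positivity
    set u : Ω → EuclideanSpace ℝ (Fin d) := fun ω => (a ω * ⟪v ω, ζ ω⟫_ℝ) • ζ ω
    have hu : Measurable[G] u := (ha.mul hin).smul hζ
    have hub : ∀ ω, ‖u ω‖ ≤ 1 := fun ω => by
      have h1 : |⟪v ω, ζ ω⟫_ℝ| ≤ ‖v ω‖ * ‖ζ ω‖ := abs_real_inner_le_norm _ _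
      simp only [u, a, norm_smul, Real.norm_eq_abs, abs_mul, abs_inv]
      rw [abs_of_pos (by positivity), abs_of_pos (by positivity), mul_assoc, inv_mul_le_iff₀
        (by positivity), mul_one]
      have := norm_nonneg (v ω)
      have := norm_nonneg (ζ ω)
      gcongr <;> linarith
    have huN : (hmem hu hub).toLp u ∈ N := by
      refine ⟨⟨u, hu.stronglyMeasurable, (hmem hu hub).coeFn_toLp⟩, ?_⟩
      filter_upwards [(hmem hu hub).coeFn_toLp, hζR] with ω h1 h2
      simp [h1, u, inner_smul_left, h2]
    have horth := (N.mem_orthogonal' _).1 hfη _ huN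
    rw [L2.inner_def] at horth
    have hae : (fun ω => ⟪(f - η) ω, ((hmem hu hub).toLp u) ω⟫_ℝ) =ᵐ[P]
        fun ω => a ω * ⟪v ω, ζ ω⟫_ℝ ^ 2 := by
      filter_upwards [Lp.coeFn_sub f η, hf, hη', (hmem hu hub).coeFn_toLp] with ω h1 h2 h3 h4
      rw [h1, h4, Pi.sub_apply, h2, h3]
      simp only [u, v, inner_smul_right]
      ring
    rw [integral_congr_ae hae, integral_eq_zero_iff_of_nonneg
      (fun ω => mul_nonneg (ha0 ω).le (sq_nonneg _)) ((L2.integrable_inner _ _).congr hae)] at horth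
    filter_upwards [horth] with ω h
    simpa [(ha0 ω).ne'] using h

/-- Orthogonal decomposition of a `G`-measurable random vector along the `G`-measurable
random vectors that are orthogonal to `R`. -/
lemma exists_orthogonal_part {Ω : Type*} {G mΩ : MeasurableSpace Ω} (hG : G ≤ mΩ)
    {P : Measure Ω} [IsProbabilityMeasure P] {d : ℕ} {R : Ω → EuclideanSpace ℝ (Fin d)}
    {π : Ω → EuclideanSpace ℝ (Fin d)} (hπ : Measurable[G] π) :
    ∃ v : Ω → EuclideanSpace ℝ (Fin d), Measurable[G] v ∧
      (∀ᵐ ω ∂P, ⟪π ω - v ω, R ω⟫_ℝ = 0) ∧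
      ∀ ζ : Ω → EuclideanSpace ℝ (Fin d), Measurable[G] ζ → (∀ᵐ ω ∂P, ⟪ζ ω, R ω⟫_ℝ = 0) →
        ∀ᵐ ω ∂P, ⟪v ω, ζ ω⟫_ℝ = 0 := by
  have hpos : ∀ ω, 0 < 1 + ‖π ω‖ := fun ω => by positivity
  obtain ⟨v, hv, h1, h2⟩ := exists_orthogonal_part_of_bounded hG (P := P) (R := R)
    (π := fun ω => (1 + ‖π ω‖)⁻¹ • π ω)
    ((measurable_const.add (measurable_norm.comp hπ)).inv.smul hπ) (fun ω => by
      rw [norm_smul, norm_inv, Real.norm_of_nonneg (hpos ω).le, inv_mul_le_iff₀ (hpos ω)]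
      linarith)
  refine ⟨fun ω => (1 + ‖π ω‖) • v ω, (measurable_const.add (measurable_norm.comp hπ)).smul hv,
    ?_, fun ζ hζ hζR => ?_⟩
  · filter_upwards [h1] with ω h
    have : π ω - (1 + ‖π ω‖) • v ω = (1 + ‖π ω‖) • ((1 + ‖π ω‖)⁻¹ • π ω - v ω) := by
      rw [smul_sub, smul_inv_smul₀ (hpos ω).ne']
    rw [this, inner_smul_left, h, mul_zero]
  · filter_upwards [h2 ζ hζ hζR] with ω h
    rw [inner_smul_left, h, mul_zero]

/-! ### Bounded logarithmic utility and its first order condition -/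

/-- A bounded approximation of the logarithmic utility. -/
def boundedLog (e x : ℝ) : ℝ := Real.log ((x + e) / (1 + e * x))

lemma measurable_boundedLog (e : ℝ) : Measurable (boundedLog e) := by
  unfold boundedLog; fun_prop

/-- The argument of the logarithm lies in [e, 1/e], so expected utilities are finite and uniformly
bounded, whatever the market. -/
lemma abs_boundedLog_le {e x : ℝ} (he : 0 < e) (he1 : e ≤ 1) (hx : 0 ≤ x) :
    |boundedLog e x| ≤ -Real.log e := by
  have h1 : e ≤ (x + e) / (1 + e * x) := by
    rw [le_div_iff₀ (by positivity)]
    nlinarith [mul_nonneg hx (mul_nonneg (sub_nonneg.2 he1) (by linarith : (0 : ℝ) ≤ 1 + e))]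
  have h2 : (x + e) / (1 + e * x) ≤ e⁻¹ := by
    rw [div_le_iff₀ (by positivity), mul_add, mul_one, inv_mul_cancel_left₀ he.ne']
    linarith [one_le_inv_iff₀.2 ⟨he, he1⟩]
  rw [abs_le, neg_neg, boundedLog]
  exact ⟨Real.log_le_log he h1, by
    simpa [Real.log_inv] using Real.log_le_log (he.trans_le h1) h2⟩

/-- The denominator in the first order condition for the maximisation of `boundedLog`, at `x` in
the direction of `g`. -/
def firstOrderDenom (e x g : ℝ) : ℝ := ((1 - e) * x + e * g + e) * (1 + e * x)

lemma firstOrderDenom_pos {e x g : ℝ} (he : 0 < e) (he1 : e ≤ 1) (hx : 0 ≤ x) (hg : 0 ≤ g) :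
    0 < firstOrderDenom e x g := by
  have : 0 ≤ (1 - e) * x := mul_nonneg (by linarith) hx
  unfold firstOrderDenom
  positivity

lemma le_firstOrderDenom {e x g : ℝ} (he : 0 < e) (he1 : e ≤ 1) (hx : 0 ≤ x) (hg : 0 ≤ g) :
    (1 - e) * x + e * g ≤ firstOrderDenom e x g := by
  have h1 : 0 ≤ (1 - e) * x := mul_nonneg (by linarith) hx
  have h2 : 0 ≤ ((1 - e) * x + e * g + e) * (e * x) := by positivity
  unfold firstOrderDenom
  nlinarith

/-- Apply log y ≥ 1 - 1/y to the ratio y of the two arguments. With z = (1 - e)x + eg, the numerator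
of 1 - 1/y collapses to (1 - e²)(z - x), and z - x = e(g - x). Here e is both the regularisation and
the mixing weight. -/
lemma le_boundedLog_sub {e x g : ℝ} (he : 0 < e) (he1 : e ≤ 1) (hx : 0 ≤ x) (hg : 0 ≤ g) :
    e * (1 - e ^ 2) * ((g - x) / firstOrderDenom e x g) ≤
      boundedLog e ((1 - e) * x + e * g) - boundedLog e x := by
  set z := (1 - e) * x + e * g with hz
  have hz0 : 0 ≤ z := add_nonneg (mul_nonneg (by linarith) hx) (by positivity)
  have ha : 0 < (z + e) / (1 + e * z) := by positivity
  have hb : 0 < (x + e) / (1 + e * x) := by positivity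
  unfold boundedLog
  rw [← Real.log_div ha.ne' hb.ne']
  refine le_trans (le_of_eq ?_) (Real.one_sub_inv_le_log_of_pos (div_pos ha hb))
  unfold firstOrderDenom
  rw [← hz]
  field_simp
  rw [hz]
  ring

/-- The first order condition for an approximate maximiser `x` of `boundedLog`. -/
lemma setLIntegral_div_firstOrderDenom_le {Ω : Type*} [MeasurableSpace Ω] {P : Measure Ω}
    [IsProbabilityMeasure P] {x g : Ω → ℝ} (hx : Measurable x) (hg : Measurable g)
    (hx0 : ∀ᵐ ω ∂P, 0 ≤ x ω) (hg0 : ∀ᵐ ω ∂P, 0 ≤ g ω) {e : ℝ} (he : 0 < e) (he2 : e ≤ 1 / 2)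
    {A : Set Ω}
    (h : ∫ ω in A, boundedLog e ((1 - e) * x ω + e * g ω) ∂P ≤
      ∫ ω in A, boundedLog e (x ω) ∂P + e ^ 2) :
    ∫⁻ ω in A, ENNReal.ofReal (g ω) / ENNReal.ofReal (firstOrderDenom e (x ω) (g ω)) ∂P ≤
      ENNReal.ofReal (1 + 2 * e) * P A + ENNReal.ofReal (2 * e) := by
  have he1 : e ≤ 1 := by linarith
  have hxA : ∀ᵐ ω ∂P.restrict A, 0 ≤ x ω := ae_restrict_of_ae hx0
  have hgA : ∀ᵐ ω ∂P.restrict A, 0 ≤ g ω := ae_restrict_of_ae hg0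
  have hD : Measurable fun ω => firstOrderDenom e (x ω) (g ω) := by
    unfold firstOrderDenom; fun_prop
  have hUi : ∀ {y : Ω → ℝ}, Measurable y → (∀ᵐ ω ∂P.restrict A, 0 ≤ y ω) →
      Integrable (fun ω => boundedLog e (y ω)) (P.restrict A) := fun hy hy0 =>
    .of_bound ((measurable_boundedLog e).comp hy).aestronglyMeasurable (-Real.log e)
      (hy0.mono fun ω h => abs_boundedLog_le he he1 h)
  have hzi := hUi (y := fun ω => (1 - e) * x ω + e * g ω) (by fun_prop) (by
    filter_upwards [hxA, hgA] with ω h1 h2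
    exact add_nonneg (mul_nonneg (by linarith) h1) (by positivity))
  have hxi := hUi hx hxA
  have hgDi : Integrable (fun ω => g ω / firstOrderDenom e (x ω) (g ω)) (P.restrict A) := by
    refine .of_bound (hg.div hD).aestronglyMeasurable (1 / e) ?_
    filter_upwards [hxA, hgA] with ω h1 h2
    have h3 := firstOrderDenom_pos he he1 h1 h2
    have h4 := le_firstOrderDenom he he1 h1 h2
    have h5 : 0 ≤ (1 - e) * x ω := mul_nonneg (by linarith) h1
    rw [Real.norm_of_nonneg (by positivity), div_le_div_iff₀ h3 he]
    linarith
  have hxD : ∀ᵐ ω ∂P.restrict A, 0 ≤ x ω / firstOrderDenom e (x ω) (g ω) ∧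
      x ω / firstOrderDenom e (x ω) (g ω) ≤ 1 + 2 * e := by
    filter_upwards [hxA, hgA] with ω h1 h2
    have h3 := firstOrderDenom_pos he he1 h1 h2
    have h4 := le_firstOrderDenom he he1 h1 h2
    refine ⟨by positivity, ?_⟩
    rw [div_le_iff₀ h3]
    -- (1 + 2e)(1 - e) = 1 + e(1 - 2e) ≥ 1 because e ≤ 1/2.
    have h5 : x ω ≤ (1 + 2 * e) * ((1 - e) * x ω) := by
      nlinarith [mul_nonneg h1 (mul_nonneg he.le (by linarith : 0 ≤ 1 - 2 * e))]
    have h6 : 0 ≤ e * g ω := by positivity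
    exact h5.trans (mul_le_mul_of_nonneg_left (by linarith) (by linarith))
  have hxDi : Integrable (fun ω => x ω / firstOrderDenom e (x ω) (g ω)) (P.restrict A) := by
    refine .of_bound (hx.div hD).aestronglyMeasurable (1 + 2 * e) ?_
    filter_upwards [hxD] with ω h1
    rw [Real.norm_of_nonneg h1.1]
    exact h1.2
  -- The gain from the deviation carries a factor e, so the tolerance e² leaves an error of order e
  -- after division.
  have key : ∫ ω in A, e * (1 - e ^ 2) * ((g ω - x ω) / firstOrderDenom e (x ω) (g ω)) ∂P ≤
      e ^ 2 := by
    have h1 : ∫ ω in A, e * (1 - e ^ 2) * ((g ω - x ω) / firstOrderDenom e (x ω) (g ω)) ∂P ≤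
        ∫ ω in A, (boundedLog e ((1 - e) * x ω + e * g ω) - boundedLog e (x ω)) ∂P := by
      refine integral_mono_ae ?_ (hzi.sub hxi) ?_
      · simp only [sub_div]
        exact (hgDi.sub hxDi).const_mul _
      · filter_upwards [hxA, hgA] with ω h1 h2 using le_boundedLog_sub he he1 h1 h2
    rw [integral_sub hzi hxi] at h1
    linarith
  simp only [sub_div] at key
  rw [integral_const_mul, integral_sub hgDi hxDi] at key
  have hx_le : ∫ ω in A, x ω / firstOrderDenom e (x ω) (g ω) ∂P ≤ (1 + 2 * e) * P.real A := by
    have := integral_mono_ae hxDi (integrable_const (1 + 2 * e)) (hxD.mono fun ω h => h.2)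
    simpa [mul_comm] using this
  have hfin : ∫ ω in A, g ω / firstOrderDenom e (x ω) (g ω) ∂P ≤
      (1 + 2 * e) * P.real A + 2 * e := by
    set a := ∫ ω in A, g ω / firstOrderDenom e (x ω) (g ω) ∂P
    set b := ∫ ω in A, x ω / firstOrderDenom e (x ω) (g ω) ∂P
    have h3 : (1 - e ^ 2) * (a - b) ≤ e := by
      refine le_of_mul_le_mul_left ?_ he
      linarith
    have h4 : a - b ≤ 2 * e := by
      by_contra! hcon
      have h5 : 3 / 4 ≤ 1 - e ^ 2 := by nlinarith
      nlinarith [mul_le_mul_of_nonneg_right h5 (by linarith : 0 ≤ a - b)]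
    linarith
  calc ∫⁻ ω in A, ENNReal.ofReal (g ω) / ENNReal.ofReal (firstOrderDenom e (x ω) (g ω)) ∂P
      = ∫⁻ ω in A, ENNReal.ofReal (g ω / firstOrderDenom e (x ω) (g ω)) ∂P := by
        refine lintegral_congr_ae ?_
        filter_upwards [hxA, hgA] with ω h1 h2
        rw [ENNReal.ofReal_div_of_pos (firstOrderDenom_pos he he1 h1 h2)]
    _ = ENNReal.ofReal (∫ ω in A, g ω / firstOrderDenom e (x ω) (g ω) ∂P) := by
        refine (ofReal_integral_eq_lintegral_ofReal hgDi ?_).symm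
        filter_upwards [hxA, hgA] with ω h1 h2
        exact div_nonneg h2 (firstOrderDenom_pos he he1 h1 h2).le
    _ ≤ ENNReal.ofReal ((1 + 2 * e) * P.real A + 2 * e) := ENNReal.ofReal_le_ofReal hfin
    _ = _ := by
        rw [ENNReal.ofReal_add (by positivity) (by positivity), ENNReal.ofReal_mul (by positivity),
          ofReal_measureReal]

/-! ### The numéraire portfolio in one period -/

/-- A bound on events known at a random index extends to the integral of a randomly indexed
sequence. -/
lemma lintegral_randomIndex_le {Ω : Type*} [MeasurableSpace Ω] {P : Measure Ω}
    [IsProbabilityMeasure P] {F : ℕ → Ω → ℝ≥0∞} {c : ℕ → ℝ≥0∞} {τ : Ω → ℕ} (hτ : Measurable τ)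
    (hF : ∀ n, ∫⁻ ω in τ ⁻¹' {n}, F n ω ∂P ≤ P (τ ⁻¹' {n}) + c n) {k : ℕ} (hk : ∀ ω, k ≤ τ ω) :
    ∫⁻ ω, F (τ ω) ω ∂P ≤ 1 + ∑' n, c (n + k) := by
  have hm : ∀ n, MeasurableSet (τ ⁻¹' {n}) := fun n => hτ (measurableSet_singleton n)
  have hd : Pairwise (Function.onFun Disjoint fun n => τ ⁻¹' {n}) := fun i j hij =>
    Disjoint.preimage τ (Set.disjoint_singleton.2 hij)
  have hU : ⋃ n, τ ⁻¹' {n} = Set.univ := by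
    ext ω; simp
  -- The cells below k are empty, so only the tail of the errors contributes.
  have hempty : ∀ n < k, τ ⁻¹' {n} = ∅ := fun n hn => by
    ext ω
    simpa using (hn.trans_le (hk ω)).ne'
  have h0 : ∀ n, ∫⁻ ω in τ ⁻¹' {n}, F (τ ω) ω ∂P = ∫⁻ ω in τ ⁻¹' {n}, F n ω ∂P := fun n =>
    setLIntegral_congr_fun (hm n) fun ω hω => by rw [show τ ω = n from hω]
  have hP : ∑' n, P (τ ⁻¹' {n}) = 1 := by
    rw [← measure_iUnion hd hm, hU, measure_univ]
  calc ∫⁻ ω, F (τ ω) ω ∂P = ∑' n, ∫⁻ ω in τ ⁻¹' {n}, F (τ ω) ω ∂P := by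
        rw [← lintegral_iUnion hm hd, hU, Measure.restrict_univ]
    _ ≤ ∑' n, (P (τ ⁻¹' {n}) + if k ≤ n then c n else 0) := by
        refine ENNReal.tsum_le_tsum fun n => ?_
        rw [h0]
        split_ifs with hn
        · exact hF n
        · simp [hempty n (not_le.1 hn)]
    _ = 1 + ∑' n, c (n + k) := by
        rw [ENNReal.tsum_add, hP, ← Summable.sum_add_tsum_nat_add' (k := k) ENNReal.summable]
        congr 1
        rw [Finset.sum_eq_zero, zero_add]
        · simp
        · intro n hn
          rw [if_neg (not_le.2 (Finset.mem_range.1 hn))]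

/-- The `G`-measurable random vectors that almost surely belong to the random set `Θ`. -/
def selections {Ω : Type*} (G : MeasurableSpace Ω) [mΩ : MeasurableSpace Ω] (P : Measure Ω)
    {d : ℕ} (Θ : Ω → Set (EuclideanSpace ℝ (Fin d))) : Set (Ω → EuclideanSpace ℝ (Fin d)) :=
  {π | Measurable[G] π ∧ ∀ᵐ ω ∂P, π ω ∈ Θ ω}

/-- The properties of the random set of allowed positions in a market with one period, initial
information `G` and returns `R` which ensure that there is a numéraire portfolio. -/
structure IsViable {Ω : Type*} (G : MeasurableSpace Ω) [mΩ : MeasurableSpace Ω] (P : Measure Ω)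
    {d : ℕ} (R : Ω → EuclideanSpace ℝ (Fin d)) (Θ : Ω → Set (EuclideanSpace ℝ (Fin d))) :
    Prop where
  isClosed : ∀ᵐ ω ∂P, IsClosed (Θ ω)
  convex : ∀ᵐ ω ∂P, Convex ℝ (Θ ω)
  zero_mem : ∀ᵐ ω ∂P, 0 ∈ Θ ω
  nonneg : ∀ π ∈ selections G P Θ, ∀ᵐ ω ∂P, 0 ≤ 1 + ⟪π ω, R ω⟫_ℝ
  sub_mem : ∀ π ∈ selections G P Θ, ∀ η : Ω → EuclideanSpace ℝ (Fin d), Measurable[G] η →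
    (∀ᵐ ω ∂P, ⟪η ω, R ω⟫_ℝ = 0) → ∀ᵐ ω ∂P, π ω - η ω ∈ Θ ω
  no_arbitrage : ∀ η : Ω → EuclideanSpace ℝ (Fin d), Measurable[G] η →
    (∀ m : ℕ, ∀ᵐ ω ∂P, (m : ℝ) • η ω ∈ Θ ω) → ∀ᵐ ω ∂P, ⟪η ω, R ω⟫_ℝ = 0

namespace IsViable

variable {Ω : Type*} {G mΩ : MeasurableSpace Ω} {P : Measure Ω} {d : ℕ}
  {R : Ω → EuclideanSpace ℝ (Fin d)} {Θ : Ω → Set (EuclideanSpace ℝ (Fin d))}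

lemma zero_mem_selections (h : IsViable G P R Θ) : (fun _ => 0) ∈ selections G P Θ :=
  ⟨measurable_const, h.zero_mem⟩

/-- A sequence of allowed positions without redundant part has a measurable random subsequence
that converges to an allowed position. -/
lemma exists_randomIndex_tendsto (h : IsViable G P R Θ)
    {π : ℕ → Ω → EuclideanSpace ℝ (Fin d)} (hπ : ∀ n, π n ∈ selections G P Θ)
    (horth : ∀ n, ∀ ζ : Ω → EuclideanSpace ℝ (Fin d), Measurable[G] ζ →
      (∀ᵐ ω ∂P, ⟪ζ ω, R ω⟫_ℝ = 0) → ∀ᵐ ω ∂P, ⟪π n ω, ζ ω⟫_ℝ = 0) :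
    ∃ τ : ℕ → Ω → ℕ, (∀ k, Measurable[G] (τ k)) ∧ (∀ k ω, k ≤ τ k ω) ∧
      ∃ ρ ∈ selections G P Θ, ∀ᵐ ω ∂P, Tendsto (fun k => π (τ k ω) ω) atTop (𝓝 (ρ ω)) := by
  classical
  -- The pair (w, c) is bounded even if π is not. Escape to infinity shows as c → 0, and there ‖w‖ =
  -- 1 - c tends to 1.
  set c : ℕ → Ω → ℝ := fun n ω => (1 + ‖π n ω‖)⁻¹
  set w : ℕ → Ω → EuclideanSpace ℝ (Fin d) := fun n ω => c n ω • π n ω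
  have hpos : ∀ n ω, 0 < c n ω := fun n ω => by positivity
  have hc1 : ∀ n ω, c n ω ≤ 1 := fun n ω => inv_le_one_of_one_le₀ (by simp)
  have hnorm : ∀ n ω, ‖w n ω‖ = 1 - c n ω := fun n ω => by
    rw [norm_smul, Real.norm_of_nonneg (hpos n ω).le]
    have : (1 + ‖π n ω‖) ≠ 0 := by positivity
    simp only [c]
    field_simp
    ring
  have hc : ∀ n, Measurable[G] (c n) := fun n =>
    (measurable_const.add (measurable_norm.comp (hπ n).1)).inv
  obtain ⟨τ, hτ, hkτ, w', c', hw', hc', hlim⟩ :=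
    exists_randomIndex_tendsto_euclidean (C := 1) (w := w)
    (fun n => (hc n).smul (hπ n).1) hc
    (fun n ω => by rw [hnorm]; linarith [hpos n ω])
    (fun n ω => by rw [abs_of_pos (hpos n ω)]; exact hc1 n ω)
  set A : Set Ω := {ω | c' ω = 0}
  have hA : MeasurableSet[G] A := hc' (measurableSet_singleton 0)
  set η := A.indicator w'
  have hη : Measurable[G] η := hw'.indicator hA
  have hηR : ∀ᵐ ω ∂P, ⟪η ω, R ω⟫_ℝ = 0 := by
    -- η is the limiting direction of an escape. Since m • w = (m c) • π with m c ≤ 1 eventually,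
    -- each m • η lies in the closed convex set Θ, which contains 0.
    refine h.no_arbitrage η hη fun m => ?_
    filter_upwards [h.isClosed, h.convex, h.zero_mem, ae_all_iff.2 fun n => (hπ n).2] with
      ω h1 h2 h3 h4
    by_cases hω : ω ∈ A
    · have hη_eq : η ω = w' ω := Set.indicator_of_mem hω _
      rw [hη_eq]
      refine h1.mem_of_tendsto ((hlim ω).1.const_smul (m : ℝ)) ?_
      have hmc : Tendsto (fun k => (m : ℝ) * c (τ k ω) ω) atTop (𝓝 0) := by
        have := (hlim ω).2.const_mul (m : ℝ)
        rwa [show c' ω = 0 from hω, mul_zero] at this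
      filter_upwards [hmc.eventually_le_const one_pos] with k hk
      rw [smul_smul]
      exact h2.smul_mem_of_zero_mem h3 (h4 _) ⟨mul_nonneg m.cast_nonneg (hpos _ _).le, hk⟩
    · have hη_eq : η ω = 0 := Set.indicator_of_notMem hω _
      rwa [hη_eq, smul_zero]
  -- Where c' = 0, every w n is orthogonal to η = w', so w' is orthogonal to itself and vanishes,
  -- against ‖w'‖ = 1.
  have hA0 : ∀ᵐ ω ∂P, c' ω ≠ 0 := by
    filter_upwards [ae_all_iff.2 fun n => horth n η hη hηR] with ω h1 hω
    have hη_eq : η ω = w' ω := Set.indicator_of_mem (s := A) hω _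
    have h2 : Tendsto (fun k => ⟪w (τ k ω) ω, η ω⟫_ℝ) atTop (𝓝 ⟪w' ω, η ω⟫_ℝ) :=
      (hlim ω).1.inner tendsto_const_nhds
    have h3 : ∀ n, ⟪w n ω, η ω⟫_ℝ = 0 := fun n => by rw [inner_smul_left, h1, mul_zero]
    simp only [h3] at h2
    have h4 : w' ω = 0 := by
      rw [hη_eq] at h2
      exact inner_self_eq_zero.1 (tendsto_nhds_unique tendsto_const_nhds h2).symm
    have h5 := (hlim ω).1.norm
    simp only [hnorm] at h5
    have h6 := tendsto_nhds_unique h5 ((hlim ω).2.const_sub 1)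
    rw [h4, hω] at h6
    norm_num at h6
  have htend : ∀ᵐ ω ∂P, Tendsto (fun k => π (τ k ω) ω) atTop (𝓝 ((c' ω)⁻¹ • w' ω)) := by
    filter_upwards [hA0] with ω hω
    refine (((hlim ω).2.inv₀ hω).smul (hlim ω).1).congr fun k => ?_
    exact inv_smul_smul₀ (hpos _ _).ne' _
  refine ⟨τ, hτ, hkτ, fun ω => (c' ω)⁻¹ • w' ω, ⟨hc'.inv.smul hw', ?_⟩, htend⟩
  filter_upwards [htend, h.isClosed, ae_all_iff.2 fun n => (hπ n).2] with ω h1 h2 h3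
  exact h2.mem_of_tendsto h1 (Eventually.of_forall fun k => h3 _)

/-- There are allowed positions without redundant part which satisfy the first order condition
for the maximisation of `boundedLog` approximately, also conditionally. -/
lemma exists_approx_maximizer [IsProbabilityMeasure P] (h : IsViable G P R Θ) (hG : G ≤ mΩ)
    (hR : Measurable R) {e : ℝ} (he : 0 < e) (he2 : e ≤ 1 / 2) :
    ∃ ρ ∈ selections G P Θ,
      (∀ ζ : Ω → EuclideanSpace ℝ (Fin d), Measurable[G] ζ →
        (∀ᵐ ω ∂P, ⟪ζ ω, R ω⟫_ℝ = 0) → ∀ᵐ ω ∂P, ⟪ρ ω, ζ ω⟫_ℝ = 0) ∧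
      ∀ π ∈ selections G P Θ, ∀ A, MeasurableSet[G] A →
        ∫⁻ ω in A, ENNReal.ofReal (1 + ⟪π ω, R ω⟫_ℝ) /
          ENNReal.ofReal (firstOrderDenom e (1 + ⟪ρ ω, R ω⟫_ℝ) (1 + ⟪π ω, R ω⟫_ℝ)) ∂P ≤
        P A + ENNReal.ofReal (4 * e) := by
  classical
  have he1 : e ≤ 1 := by linarith
  have hmeas : ∀ {π : Ω → EuclideanSpace ℝ (Fin d)}, Measurable[G] π →
      Measurable fun ω => 1 + ⟪π ω, R ω⟫_ℝ := fun hπ =>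
    measurable_const.add ((hπ.mono hG le_rfl).inner hR)
  have hbound : ∀ π ∈ selections G P Θ, ∀ᵐ ω ∂P,
      ‖boundedLog e (1 + ⟪π ω, R ω⟫_ℝ)‖ ≤ -Real.log e := fun π hπ => by
    filter_upwards [h.nonneg π hπ] with ω h1 using abs_boundedLog_le he he1 h1
  have hint : ∀ π ∈ selections G P Θ,
      Integrable (fun ω => boundedLog e (1 + ⟪π ω, R ω⟫_ℝ)) P := fun π hπ =>
    .of_bound ((measurable_boundedLog e).comp (hmeas hπ.1)).aestronglyMeasurable _ (hbound π hπ)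
  set u : (Ω → EuclideanSpace ℝ (Fin d)) → ℝ := fun π =>
    ∫ ω, boundedLog e (1 + ⟪π ω, R ω⟫_ℝ) ∂P
  have hbdd : BddAbove (u '' selections G P Θ) := by
    refine ⟨-Real.log e, ?_⟩
    rintro _ ⟨π, hπ, rfl⟩
    have := norm_integral_le_of_norm_le_const (hbound π hπ)
    rw [probReal_univ, mul_one] at this
    exact (le_abs_self _).trans this
  obtain ⟨_, ⟨π₀, hπ₀, rfl⟩, hlt⟩ := exists_lt_of_lt_csSup
    (Set.Nonempty.image u ⟨_, h.zero_mem_selections⟩)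
    (sub_lt_self (sSup (u '' selections G P Θ)) (by positivity : 0 < e ^ 2))
  -- Dropping the redundant part keeps the return, hence the utility, and stays in Θ by `sub_mem`.
  obtain ⟨ρ, hρm, hρR, horth⟩ := exists_orthogonal_part hG (P := P) (R := R) hπ₀.1
  have hρ : ρ ∈ selections G P Θ := by
    refine ⟨hρm, ?_⟩
    filter_upwards [h.sub_mem π₀ hπ₀ (fun ω => π₀ ω - ρ ω) (hπ₀.1.sub hρm) hρR] with ω h1
    simpa using h1
  have hu : u ρ = u π₀ := by
    refine integral_congr_ae ?_
    filter_upwards [hρR] with ω h1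
    rw [inner_sub_left, sub_eq_zero] at h1
    simp only [h1]
  have hmax : ∀ π ∈ selections G P Θ, u π ≤ u ρ + e ^ 2 := fun π hπ => by
    have := le_csSup hbdd ⟨π, hπ, rfl⟩
    rw [hu]
    linarith
  refine ⟨ρ, hρ, horth, fun π hπ A hA => ?_⟩
  set z : Ω → EuclideanSpace ℝ (Fin d) := fun ω => (1 - e) • ρ ω + e • π ω
  have hz : z ∈ selections G P Θ := by
    refine ⟨(hρ.1.const_smul (1 - e)).add (hπ.1.const_smul e), ?_⟩
    filter_upwards [h.convex, hρ.2, hπ.2] with ω h1 h2 h3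
    exact h1 h2 h3 (by linarith) he.le (by ring)
  -- Deviate only on A, which is known when the position is chosen; the utilities off A cancel in
  -- the comparison.
  have hmix : A.piecewise z ρ ∈ selections G P Θ := by
    refine ⟨hz.1.piecewise hA hρ.1, ?_⟩
    filter_upwards [hρ.2, hz.2] with ω h1 h2
    by_cases hω : ω ∈ A <;> simpa [hω]
  have h1 := hmax _ hmix
  have hpw : (fun ω => boundedLog e (1 + ⟪A.piecewise z ρ ω, R ω⟫_ℝ)) =
      A.piecewise (fun ω => boundedLog e (1 + ⟪z ω, R ω⟫_ℝ))
        (fun ω => boundedLog e (1 + ⟪ρ ω, R ω⟫_ℝ)) := by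
    ext ω
    by_cases hω : ω ∈ A <;> simp [hω]
  simp only [u] at h1
  rw [hpw, integral_piecewise (hG _ hA) (hint z hz).integrableOn (hint ρ hρ).integrableOn,
    ← integral_add_compl (hG _ hA) (hint ρ hρ)] at h1
  have hz_eq : ∀ ω, 1 + ⟪z ω, R ω⟫_ℝ =
      (1 - e) * (1 + ⟪ρ ω, R ω⟫_ℝ) + e * (1 + ⟪π ω, R ω⟫_ℝ) := fun ω => by
    simp only [z, inner_add_left, real_inner_smul_left]
    ring
  simp only [hz_eq] at h1
  refine (setLIntegral_div_firstOrderDenom_le (hmeas hρ.1) (hmeas hπ.1) (h.nonneg ρ hρ)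
    (h.nonneg π hπ) he he2 (A := A) (by linarith)).trans ?_
  calc ENNReal.ofReal (1 + 2 * e) * P A + ENNReal.ofReal (2 * e)
      = P A + ENNReal.ofReal (2 * e) * P A + ENNReal.ofReal (2 * e) := by
        rw [ENNReal.ofReal_add zero_le_one (by positivity), ENNReal.ofReal_one, add_mul, one_mul]
    _ ≤ P A + ENNReal.ofReal (2 * e) * 1 + ENNReal.ofReal (2 * e) := by gcongr; exact prob_le_one
    _ = P A + ENNReal.ofReal (4 * e) := by
        rw [mul_one, add_assoc, ← ENNReal.ofReal_add (by positivity) (by positivity)]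
        ring_nf

/-- Existence of the numéraire portfolio in a market with one period. -/
theorem exists_numeraire [IsProbabilityMeasure P] (h : IsViable G P R Θ) (hG : G ≤ mΩ)
    (hR : Measurable R) :
    ∃ ρ ∈ selections G P Θ, (∀ᵐ ω ∂P, 0 < 1 + ⟪ρ ω, R ω⟫_ℝ) ∧
      ∀ π ∈ selections G P Θ, ∀ A, MeasurableSet[G] A →
        ∫⁻ ω in A, ENNReal.ofReal ((1 + ⟪π ω, R ω⟫_ℝ) / (1 + ⟪ρ ω, R ω⟫_ℝ)) ∂P ≤ P A := by
  classical
  -- Summability matters: at a random index the errors add up over all its possible values, and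
  -- their tails must vanish.
  set e : ℕ → ℝ := fun n => (1 / 2) ^ n * (1 / 2)
  have he : ∀ n, 0 < e n := fun n => by positivity
  have he2 : ∀ n, e n ≤ 1 / 2 := fun n =>
    mul_le_of_le_one_left (by norm_num) (pow_le_one₀ (by norm_num) (by norm_num))
  have hesum : Summable e := summable_geometric_two.mul_right _
  have hmeas : ∀ {π : Ω → EuclideanSpace ℝ (Fin d)}, Measurable[G] π →
      Measurable fun ω => 1 + ⟪π ω, R ω⟫_ℝ := fun hπ =>
    measurable_const.add ((hπ.mono hG le_rfl).inner hR)
  choose σ hσ horth hmax using fun n => h.exists_approx_maximizer hG hR (he n) (he2 n)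
  obtain ⟨τ, hτ, hkτ, ρ, hρ, hlim⟩ := h.exists_randomIndex_tendsto hσ horth
  have hτ' : ∀ k, Measurable (τ k) := fun k => (hτ k).mono hG le_rfl
  have key : ∀ π ∈ selections G P Θ,
      ∫⁻ ω, ENNReal.ofReal (1 + ⟪π ω, R ω⟫_ℝ) / ENNReal.ofReal (1 + ⟪ρ ω, R ω⟫_ℝ) ∂P ≤ 1 := by
    intro π hπ
    set F : ℕ → Ω → ℝ≥0∞ := fun n ω => ENNReal.ofReal (1 + ⟪π ω, R ω⟫_ℝ) /
      ENNReal.ofReal (firstOrderDenom (e n) (1 + ⟪σ n ω, R ω⟫_ℝ) (1 + ⟪π ω, R ω⟫_ℝ))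
    have hF : ∀ n, Measurable (F n) := fun n => by
      have h1 := hmeas hπ.1
      have h2 := hmeas (hσ n).1
      simp only [F, firstOrderDenom]
      fun_prop
    have hbd : ∀ k, ∫⁻ ω, F (τ k ω) ω ∂P ≤ 1 + ∑' n, ENNReal.ofReal (4 * e (n + k)) := fun k =>
      lintegral_randomIndex_le (c := fun n => ENNReal.ofReal (4 * e n)) (hτ' k)
        (fun n => hmax n π hπ _ (hτ k (measurableSet_singleton n))) (hkτ k)
    have htail : Tendsto (fun k => 1 + ∑' n, ENNReal.ofReal (4 * e (n + k))) atTop (𝓝 1) := by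
      have := (ENNReal.tendsto_sum_nat_add (fun n => ENNReal.ofReal (4 * e n))
        (hesum.mul_left 4).tsum_ofReal_ne_top).const_add 1
      rwa [add_zero] at this
    have hFlim : ∀ᵐ ω ∂P, liminf (fun k => F (τ k ω) ω) atTop =
        ENNReal.ofReal (1 + ⟪π ω, R ω⟫_ℝ) / ENNReal.ofReal (1 + ⟪ρ ω, R ω⟫_ℝ) := by
      filter_upwards [hlim] with ω hω
      have hx : Tendsto (fun k => 1 + ⟪σ (τ k ω) ω, R ω⟫_ℝ) atTop (𝓝 (1 + ⟪ρ ω, R ω⟫_ℝ)) :=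
        (hω.inner tendsto_const_nhds).const_add 1
      have hee : Tendsto (fun k => e (τ k ω)) atTop (𝓝 0) :=
        hesum.tendsto_atTop_zero.comp (tendsto_atTop_mono (fun k => hkτ k ω) tendsto_id)
      have hD : Tendsto (fun k => firstOrderDenom (e (τ k ω)) (1 + ⟪σ (τ k ω) ω, R ω⟫_ℝ)
          (1 + ⟪π ω, R ω⟫_ℝ)) atTop (𝓝 (1 + ⟪ρ ω, R ω⟫_ℝ)) := by
        have := ((((hee.const_sub 1).mul hx).add (hee.mul_const (1 + ⟪π ω, R ω⟫_ℝ))).add hee).mul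
          ((hee.mul hx).const_add 1)
        simpa only [sub_zero, one_mul, zero_mul, add_zero, mul_one, firstOrderDenom] using this
      -- Positivity of the limiting denominator is not yet known; in ℝ≥0∞ a quotient with finite
      -- numerator is continuous in the denominator even at 0.
      exact (ENNReal.Tendsto.const_mul (tendsto_inv_iff.2 (ENNReal.tendsto_ofReal hD))
        (Or.inr ENNReal.ofReal_ne_top)).liminf_eq
    calc ∫⁻ ω, ENNReal.ofReal (1 + ⟪π ω, R ω⟫_ℝ) / ENNReal.ofReal (1 + ⟪ρ ω, R ω⟫_ℝ) ∂P
        = ∫⁻ ω, liminf (fun k => F (τ k ω) ω) atTop ∂P :=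
          lintegral_congr_ae (hFlim.mono fun ω hω => hω.symm)
      _ ≤ liminf (fun k => ∫⁻ ω, F (τ k ω) ω ∂P) atTop :=
          lintegral_liminf_le fun k => measurable_comp_randomIndex hF (hτ' k)
      _ ≤ liminf (fun k => 1 + ∑' n, ENNReal.ofReal (4 * e (n + k))) atTop :=
          liminf_le_liminf (Eventually.of_forall hbd)
      _ = 1 := htail.liminf_eq
  -- Comparison with the zero position gives E[1/(1 + ⟨ρ, R⟩)] ≤ 1 with 1/0 = ∞, so the denominator
  -- is almost surely positive.
  have hρpos : ∀ᵐ ω ∂P, 0 < 1 + ⟪ρ ω, R ω⟫_ℝ := by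
    have h0 := key _ h.zero_mem_selections
    simp only [inner_zero_left, add_zero, ENNReal.ofReal_one] at h0
    filter_upwards [ae_lt_top ((hmeas hρ.1).ennreal_ofReal.const_div 1)
      (h0.trans_lt ENNReal.one_lt_top).ne] with ω hω
    by_contra! hcon
    simp [ENNReal.ofReal_of_nonpos hcon] at hω
  refine ⟨ρ, hρ, hρpos, fun π hπ A hA => ?_⟩
  -- Off A the pasted position has ratio 1 and contributes P Aᶜ, which cancels and leaves the bound
  -- on A.
  have hmix : A.piecewise π ρ ∈ selections G P Θ := by
    refine ⟨hπ.1.piecewise hA hρ.1, ?_⟩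
    filter_upwards [hρ.2, hπ.2] with ω h1 h2
    by_cases hω : ω ∈ A <;> simpa [hω]
  have h1 := key _ hmix
  rw [← lintegral_add_compl _ (hG _ hA)] at h1
  have h2 : ∫⁻ ω in A, ENNReal.ofReal (1 + ⟪A.piecewise π ρ ω, R ω⟫_ℝ) /
      ENNReal.ofReal (1 + ⟪ρ ω, R ω⟫_ℝ) ∂P =
      ∫⁻ ω in A, ENNReal.ofReal ((1 + ⟪π ω, R ω⟫_ℝ) / (1 + ⟪ρ ω, R ω⟫_ℝ)) ∂P := by
    refine lintegral_congr_ae ?_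
    filter_upwards [ae_restrict_of_ae hρpos, ae_restrict_mem (hG _ hA)] with ω h3 h4
    rw [ENNReal.ofReal_div_of_pos h3, Set.piecewise_eq_of_mem _ _ _ h4]
  have h3 : ∫⁻ ω in Aᶜ, ENNReal.ofReal (1 + ⟪A.piecewise π ρ ω, R ω⟫_ℝ) /
      ENNReal.ofReal (1 + ⟪ρ ω, R ω⟫_ℝ) ∂P = P Aᶜ := by
    rw [← setLIntegral_one]
    refine lintegral_congr_ae ?_
    filter_upwards [ae_restrict_of_ae hρpos, ae_restrict_mem (hG _ hA).compl] with ω h3 h4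
    rw [Set.piecewise_eq_of_notMem _ _ _ h4]
    exact ENNReal.div_self (ENNReal.ofReal_pos.2 h3).ne' ENNReal.ofReal_ne_top
  rw [h2, h3, ← prob_add_prob_compl (μ := P) (hG _ hA)] at h1
  exact (ENNReal.add_le_add_iff_right (measure_ne_top P _)).1 h1

end IsViable

/-! ### Conditional supports and almost sure statements -/

/-- A property of a pair of random elements holds almost surely if and only if it holds almost
surely with respect to the conditional distribution. -/
lemma ae_iff_ae_condDistrib {α β E : Type*} {mα : MeasurableSpace α} {mβ : MeasurableSpace β}
    [MeasurableSpace E] [StandardBorelSpace E] [Nonempty E] {μ : Measure α} [IsFiniteMeasure μ]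
    {X : α → β} {Y : α → E} (hX : Measurable X) (hY : Measurable Y) {p : β → E → Prop}
    (hp : MeasurableSet {x : β × E | p x.1 x.2}) :
    (∀ᵐ a ∂μ, p (X a) (Y a)) ↔ ∀ᵐ a ∂μ, ∀ᵐ z ∂(condDistrib Y X μ (X a)), p (X a) z := by
  have h1 := ae_map_iff (μ := μ) (hX.prodMk hY).aemeasurable hp
  have hset : MeasurableSet {b | ∀ᵐ z ∂(condDistrib Y X μ b), p b z} :=
    Kernel.measurable_kernel_prodMk_left (κ := condDistrib Y X μ) hp.compl
      (measurableSet_singleton 0)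
  have h3 := Measure.ae_compProd_iff (μ := μ.map X) (κ := condDistrib Y X μ) hp
  rw [compProd_map_condDistrib hY.aemeasurable] at h3
  exact h1.symm.trans (h3.trans (ae_map_iff hX.aemeasurable hset))

/-- The support lies in every closed set of full measure, and the hereditary Lindelöf property makes
it carry the measure itself. -/
lemma ae_mem_iff_support_subset {X : Type*} [TopologicalSpace X] [HereditarilyLindelofSpace X]
    [MeasurableSpace X] {μ : Measure X} {S : Set X} (hS : IsClosed S) :
    (∀ᵐ x ∂μ, x ∈ S) ↔ μ.support ⊆ S :=
  ⟨fun h => Measure.support_subset_of_isClosed hS h,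
    fun h => mem_of_superset Measure.support_mem_ae h⟩

/-- A property which is closed in the values of `X` holds almost surely if and only if it holds
almost surely on the conditional support of `X`. -/
lemma ae_iff_forall_condSupport {Ω : Type*} {m mΩ : MeasurableSpace Ω} (hm : m ≤ mΩ)
    {P : Measure Ω} [IsProbabilityMeasure P] {d : ℕ} {X : Ω → EuclideanSpace ℝ (Fin d)}
    (hX : Measurable X) {p : Ω → EuclideanSpace ℝ (Fin d) → Prop}
    (hp : MeasurableSet[m.prod inferInstance] {x : Ω × EuclideanSpace ℝ (Fin d) | p x.1 x.2})
    (hcl : ∀ ω, IsClosed {z | p ω z}) :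
    (∀ᵐ ω ∂P, p ω (X ω)) ↔ ∀ᵐ ω ∂P, ∀ z ∈ condSupport m P X ω, p ω z := by
  have hid : @Measurable Ω Ω mΩ m id := measurable_id'' hm
  refine (ae_iff_ae_condDistrib hid hX hp).trans
    (eventually_congr (Eventually.of_forall fun ω => ?_))
  exact ae_mem_iff_support_subset (hcl ω)

/-- This translates between constraints on the conditional support and almost sure properties of
returns: S = [-1, ∞) serves for admissibility, S = {0} for redundant positions. -/
lemma ae_inner_mem_iff {Ω : Type*} {m mΩ : MeasurableSpace Ω} (hm : m ≤ mΩ)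
    {P : Measure Ω} [IsProbabilityMeasure P] {d : ℕ} {X : Ω → EuclideanSpace ℝ (Fin d)}
    (hX : Measurable X) {π : Ω → EuclideanSpace ℝ (Fin d)} (hπ : Measurable[m] π)
    {S : Set ℝ} (hS : IsClosed S) :
    (∀ᵐ ω ∂P, ⟪π ω, X ω⟫_ℝ ∈ S) ↔ ∀ᵐ ω ∂P, ∀ z ∈ condSupport m P X ω, ⟪π ω, z⟫_ℝ ∈ S := by
  refine ae_iff_forall_condSupport hm hX (p := fun ω z => ⟪π ω, z⟫_ℝ ∈ S) ?_ fun ω =>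
    hS.preimage (continuous_const.inner continuous_id)
  exact Measurable.inner
    (@Measurable.comp _ _ _ (m.prod inferInstance) m _ _ _ hπ (@measurable_fst _ _ m _))
    (@measurable_snd _ _ m _) hS.measurableSet

/-! ### Wealth processes and viability of each period -/

namespace MarketModel

variable {Ω : Type*} [mΩ : MeasurableSpace Ω] {P : Measure Ω} [IsProbabilityMeasure P]
  {T d : ℕ} {M : MarketModel P T d}

lemma measurable_R (k : Fin T) : Measurable (M.R k) :=
  (M.R_measurable k).mono (M.F.le _) le_rfl

lemma measurable_return {π : Fin T → Ω → EuclideanSpace ℝ (Fin d)} (hπ : M.Allowed π)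
    (k : Fin T) : Measurable[M.F k.succ] fun ω => 1 + ⟪π k ω, M.R k ω⟫_ℝ :=
  measurable_const.add (((hπ k).1.mono (M.F.mono (Fin.castSucc_le_succ k)) le_rfl).inner
    (M.R_measurable k))

lemma measurable_wealth {π : Fin T → Ω → EuclideanSpace ℝ (Fin d)} (hπ : M.Allowed π) (v : ℝ)
    (t : Fin (T + 1)) : Measurable[M.F t] (M.wealth v π t) := by
  refine measurable_const.mul (Finset.measurable_fun_prod _ fun k hk => ?_)
  exact (measurable_return hπ k).mono (M.F.mono (Finset.mem_filter.1 hk).2) le_rfl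

lemma nonneg_return {π : Fin T → Ω → EuclideanSpace ℝ (Fin d)} (hπ : M.Allowed π) (k : Fin T) :
    ∀ᵐ ω ∂P, 0 ≤ 1 + ⟪π k ω, M.R k ω⟫_ℝ := by
  have h := (ae_inner_mem_iff (M.F.le _) (measurable_R k) (hπ k).1 (isClosed_Ici (a := -1))).2
    ((hπ k).2.mono fun ω h => h.1)
  filter_upwards [h] with ω h1
  linarith [Set.mem_Ici.1 h1]

lemma nonneg_wealth {π : Fin T → Ω → EuclideanSpace ℝ (Fin d)} (hπ : M.Allowed π) {v : ℝ}
    (hv : 0 ≤ v) (t : Fin (T + 1)) : ∀ᵐ ω ∂P, 0 ≤ M.wealth v π t ω := by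
  filter_upwards [ae_all_iff.2 (nonneg_return hπ)] with ω h
  exact mul_nonneg hv (Finset.prod_nonneg fun k _ => h k)

lemma wealth_eq_mul (v : ℝ) (π : Fin T → Ω → EuclideanSpace ℝ (Fin d)) (t : Fin (T + 1)) (ω : Ω) :
    M.wealth v π t ω = v * M.wealth 1 π t ω := by
  simp [wealth]

lemma wealth_zero (v : ℝ) (π : Fin T → Ω → EuclideanSpace ℝ (Fin d)) (ω : Ω) :
    M.wealth v π 0 ω = v := by
  simp [wealth, Finset.filter_false_of_mem]

lemma wealth_succ (v : ℝ) (π : Fin T → Ω → EuclideanSpace ℝ (Fin d)) (k : Fin T) (ω : Ω) :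
    M.wealth v π k.succ ω = M.wealth v π k.castSucc ω * (1 + ⟪π k ω, M.R k ω⟫_ℝ) := by
  have h : (Finset.univ.filter fun j : Fin T => j.succ ≤ k.succ) =
      insert k (Finset.univ.filter fun j : Fin T => j.succ ≤ k.castSucc) := by
    ext j
    simp only [Finset.mem_filter, Finset.mem_univ, true_and, Finset.mem_insert, Fin.le_def,
      Fin.ext_iff, Fin.val_succ, Fin.val_castSucc]
    omega
  rw [wealth, wealth, h, Finset.prod_insert (by simp [Fin.le_def]), mul_assoc, mul_comm (_ + _)]

lemma zero_mem_Θ (M : MarketModel P T d) (k : Fin T) : ∀ᵐ ω ∂P, 0 ∈ M.Θ k ω := by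
  filter_upwards [M.orthogonal_subset k] with ω h
  exact ⟨fun z _ => by simp, h (Submodule.zero_mem _)⟩

/-- Holding nothing in the other periods is allowed; through such strategies the condition `NA1` at
the final date constrains each period separately. -/
lemma allowed_single (k : Fin T) {η : Ω → EuclideanSpace ℝ (Fin d)}
    (hη : Measurable[M.F k.castSucc] η) (hΘ : ∀ᵐ ω ∂P, η ω ∈ M.Θ k ω) :
    M.Allowed (Pi.single k η) := by
  intro j
  rcases eq_or_ne j k with rfl | hj
  · simpa using ⟨hη, hΘ⟩
  · rw [Pi.single_eq_of_ne hj]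
    exact ⟨measurable_const, M.zero_mem_Θ j⟩

lemma wealth_single (v : ℝ) (k : Fin T) (η : Ω → EuclideanSpace ℝ (Fin d)) (ω : Ω) :
    M.wealth v (Pi.single k η) (Fin.last T) ω = v * (1 + ⟪η ω, M.R k ω⟫_ℝ) := by
  rw [wealth, Finset.prod_eq_single k]
  · simp
  · intro j _ hj
    simp [Pi.single_eq_of_ne hj]
  · simp [Fin.le_last]

lemma Θ_isClosed (k : Fin T) (ω : Ω) : IsClosed (M.Θ k ω) := by
  refine IsClosed.inter ?_ (M.Θc_closed k ω)
  simp only [Θadm, Set.ofPred_forall]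
  exact isClosed_biInter fun z _ =>
    isClosed_le continuous_const (continuous_id.inner continuous_const)

lemma Θ_convex (k : Fin T) (ω : Ω) : Convex ℝ (M.Θ k ω) := by
  refine Convex.inter (fun x hx y hy a b ha hb hab z hz => ?_) (M.Θc_convex k ω)
  rw [inner_add_left, real_inner_smul_left, real_inner_smul_left]
  nlinarith [mul_le_mul_of_nonneg_left (hx z hz) ha, mul_le_mul_of_nonneg_left (hy z hz) hb]

/-- A closed convex set which contains a linear subspace is stable under translation by elements of
the subspace. -/
lemma _root_.Convex.sub_mem_of_submodule_subset {E : Type*} [AddCommGroup E] [Module ℝ E]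
    [TopologicalSpace E] [IsTopologicalAddGroup E] [ContinuousSMul ℝ E] {C : Set E}
    (hC : Convex ℝ C) (hcl : IsClosed C) {N : Submodule ℝ E} (hN : (N : Set E) ⊆ C) {x y : E}
    (hx : x ∈ C) (hy : y ∈ N) : x - y ∈ C := by
  have h1 : Tendsto (fun a : ℝ => (1 - a) • x - y) (𝓝[>] 0) (𝓝 (x - y)) := by
    have : Tendsto (fun a : ℝ => (1 - a) • x - y) (𝓝 0) (𝓝 ((1 - 0 : ℝ) • x - y)) :=
      Continuous.tendsto (by fun_prop) 0
    simpa using this.mono_left nhdsWithin_le_nhds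
  refine hcl.mem_of_tendsto h1 ?_
  -- (1 - a)x - y is the convex combination of x and -y/a, where -y/a stays in the subspace however
  -- small a is.
  filter_upwards [Ioc_mem_nhdsGT (zero_lt_one' ℝ)] with a ha
  have h2 : -(a⁻¹ • y) ∈ C := hN (N.neg_mem (N.smul_mem _ hy))
  have h3 := hC hx h2 (sub_nonneg.2 ha.2) ha.1.le (by ring)
  rwa [smul_neg, smul_inv_smul₀ ha.1.ne', ← sub_eq_add_neg] at h3

/-- Without arbitrage of the first kind every period is viable. -/
lemma NA1.isViable (hNA : M.NA1) (k : Fin T) :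
    IsViable (M.F k.castSucc) P (M.R k) (M.Θ k) where
  isClosed := .of_forall (Θ_isClosed k)
  convex := .of_forall (Θ_convex k)
  zero_mem := M.zero_mem_Θ k
  nonneg π hπ := by simpa using nonneg_return (allowed_single k hπ.1 hπ.2) k
  sub_mem π hπ η hη hηR := by
    have h := (ae_inner_mem_iff (M.F.le _) (measurable_R k) hη
      (isClosed_singleton (x := (0 : ℝ)))).1
      hηR
    filter_upwards [h, hπ.2, M.orthogonal_subset k] with ω h1 h2 h3
    refine ⟨fun z hz => ?_,
      (M.Θc_convex k ω).sub_mem_of_submodule_subset (M.Θc_closed k ω) h3 h2.2 ?_⟩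
    · rw [inner_sub_left, show ⟪η ω, z⟫_ℝ = 0 from h1 z hz, sub_zero]
      exact h2.1 z hz
    · rw [condSpan, Submodule.mem_orthogonal']
      intro z hz
      induction hz using Submodule.span_induction with
      | mem z hz => exact h1 z hz
      | zero => exact inner_zero_right _
      | add x y _ _ hx hy => rw [inner_add_right, hx, hy, add_zero]
      | smul a x _ hx => rw [inner_smul_right, hx, mul_zero]
  no_arbitrage η hη hm := by
    have hmη : ∀ m : ℕ, M.Allowed (Pi.single k fun ω => (m : ℝ) • η ω) := fun m =>
      allowed_single k (hη.const_smul (m : ℝ)) (hm m)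
    have hnn : ∀ᵐ ω ∂P, ∀ m : ℕ, 0 ≤ 1 + m * ⟪η ω, M.R k ω⟫_ℝ := ae_all_iff.2 fun m => by
      simpa [inner_smul_left] using nonneg_return (hmη m) k
    have hξ : Measurable[M.F (Fin.last T)] fun ω => ⟪η ω, M.R k ω⟫_ℝ :=
      (hη.mono (M.F.mono (Fin.le_last _)) le_rfl).inner
        ((M.R_measurable k).mono (M.F.mono (Fin.le_last _)) le_rfl)
    -- Put ξ = ⟨η, R⟩. As 1 + mξ ≥ 0 for all m, ξ is nonnegative; capital 1/(m + 1) in the position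
    -- (m + 1)η ends at 1/(m + 1) + ξ, so ξ has super-hedging value 0.
    refine hNA _ hξ ?_ ?_
    · filter_upwards [hnn] with ω h
      by_contra! hneg
      obtain ⟨m, hm⟩ := exists_nat_gt (1 / -⟪η ω, M.R k ω⟫_ℝ)
      rw [div_lt_iff₀ (by linarith)] at hm
      linarith [h m]
    · have hle : ∀ m : ℕ, M.superhedgeValue (fun ω => ⟪η ω, M.R k ω⟫_ℝ) ≤
          ENNReal.ofReal (1 / ((m : ℝ) + 1)) := fun m => by
        refine sInf_le ⟨1 / ((m : ℝ) + 1), by positivity, rfl, _, hmη (m + 1), ?_⟩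
        refine Eventually.of_forall fun ω => ?_
        rw [wealth_single, real_inner_smul_left]
        have : (0 : ℝ) < m + 1 := by positivity
        push_cast
        field_simp
        linarith
      have hlim := ENNReal.tendsto_ofReal (tendsto_one_div_add_atTop_nhds_zero_nat (𝕜 := ℝ))
      rw [ENNReal.ofReal_zero] at hlim
      exact le_antisymm (ge_of_tendsto' hlim hle) zero_le

/-! ### From a deflator to absence of arbitrage -/

/-- A supermartingale deflator excludes arbitrage of the first kind. -/
lemma IsDeflator.na1 {Z : Fin (T + 1) → Ω → ℝ} (hZ : M.IsDeflator Z) : M.NA1 := by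
  intro ξ hξ hξ0 hv
  set Y : Ω → ℝ≥0∞ := fun ω => ENNReal.ofReal (Z (Fin.last T) ω * ξ ω)
  have hbound : ∀ v : ℝ, 0 < v → (∃ π, M.Allowed π ∧
      ∀ᵐ ω ∂P, ξ ω ≤ M.wealth v π (Fin.last T) ω) → ∫⁻ ω, Y ω ∂P ≤ ENNReal.ofReal v := by
    rintro v hv ⟨π, hπ, hle⟩
    have hsup := hZ.supermartingale π hπ
    have h1 := hsup.setIntegral_le (Fin.zero_le (Fin.last T)) (MeasurableSet.univ)
    have h2 : ∫ ω, Z 0 ω * M.wealth 1 π 0 ω ∂P = 1 := by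
      rw [integral_congr_ae (g := fun _ => 1)]
      · simp
      · filter_upwards [hZ.zero_eq] with ω h
        rw [h, wealth_zero, one_mul]
    rw [setIntegral_univ, setIntegral_univ, h2] at h1
    calc ∫⁻ ω, Y ω ∂P
        ≤ ∫⁻ ω, ENNReal.ofReal (v * (Z (Fin.last T) ω * M.wealth 1 π (Fin.last T) ω)) ∂P := by
          refine lintegral_mono_ae ?_
          filter_upwards [hle, hZ.pos (Fin.last T)] with ω h3 h4
          refine ENNReal.ofReal_le_ofReal ?_
          rw [wealth_eq_mul] at h3
          linarith [mul_le_mul_of_nonneg_left h3 h4.le]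
      _ = ENNReal.ofReal (∫ ω, v * (Z (Fin.last T) ω * M.wealth 1 π (Fin.last T) ω) ∂P) := by
          refine (ofReal_integral_eq_lintegral_ofReal ((hsup.integrable _).const_mul v) ?_).symm
          filter_upwards [nonneg_wealth hπ zero_le_one (Fin.last T), hZ.pos (Fin.last T)] with
            ω h3 h4
          exact mul_nonneg hv.le (mul_nonneg h4.le h3)
      _ ≤ ENNReal.ofReal v := by
          rw [integral_const_mul]
          exact ENNReal.ofReal_le_ofReal (mul_le_of_le_one_right hv.le h1)
  have hY0 : ∫⁻ ω, Y ω ∂P = 0 := by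
    refine le_antisymm ?_ zero_le
    rw [← hv]
    refine le_sInf ?_
    rintro _ ⟨v, hv, rfl, hπ⟩
    exact hbound v hv hπ
  have hYm : Measurable Y := ((((hZ.adapted _).mono (M.F.le _) le_rfl)).mul
    (hξ.mono (M.F.le _) le_rfl)).ennreal_ofReal
  filter_upwards [(lintegral_eq_zero_iff hYm).1 hY0, hξ0, hZ.pos (Fin.last T)] with ω h1 h2 h3
  have h4 : Z (Fin.last T) ω * ξ ω ≤ 0 := by simpa [Y] using h1
  exact le_antisymm (nonpos_of_mul_nonpos_right h4 h3) h2

end MarketModel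

/-! ### Composing the periods into a supermartingale -/

/-- If the `G`-conditional expectation of `r` is at most one, then multiplication by `r` decreases
the integrals of nonnegative `G`-measurable functions. -/
lemma setLIntegral_mul_le_of_forall_setLIntegral_le {Ω : Type*} {G mΩ : MeasurableSpace Ω}
    (hG : G ≤ mΩ) {P : Measure Ω} {r Y : Ω → ℝ≥0∞} (hr : Measurable r) (hY : Measurable[G] Y)
    (h : ∀ A, MeasurableSet[G] A → ∫⁻ ω in A, r ω ∂P ≤ P A) {B : Set Ω} (hB : MeasurableSet[G] B) :
    ∫⁻ ω in B, Y ω * r ω ∂P ≤ ∫⁻ ω in B, Y ω ∂P := by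
  have hY' : Measurable[G] (B.indicator Y) := hY.indicator hB
  -- The hypothesis says that r·P is dominated by P on G, which suffices for integrals of
  -- nonnegative G-measurable functions.
  have hle : (P.withDensity r).trim hG ≤ P.trim hG := by
    refine Measure.le_iff.2 fun A hA => ?_
    rw [trim_measurableSet_eq hG hA, trim_measurableSet_eq hG hA, withDensity_apply _ (hG _ hA)]
    exact h A hA
  calc ∫⁻ ω in B, Y ω * r ω ∂P = ∫⁻ ω, r ω * B.indicator Y ω ∂P := by
        rw [← lintegral_indicator (hG _ hB)]
        refine lintegral_congr fun ω => ?_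
        by_cases hω : ω ∈ B <;> simp [hω, mul_comm]
    _ = ∫⁻ ω, B.indicator Y ω ∂(P.withDensity r) :=
        (lintegral_withDensity_eq_lintegral_mul P hr (hY'.mono hG le_rfl)).symm
    _ = ∫⁻ ω, B.indicator Y ω ∂((P.withDensity r).trim hG) := (lintegral_trim hG hY').symm
    _ ≤ ∫⁻ ω, B.indicator Y ω ∂(P.trim hG) := lintegral_mono' hle le_rfl
    _ = ∫⁻ ω in B, Y ω ∂P := by rw [lintegral_trim hG hY', lintegral_indicator (hG _ hB)]

/-- A nonnegative adapted process on finitely many dates, integrable at the initial date, whose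
integrals decrease in each period is a supermartingale. -/
lemma supermartingale_of_setLIntegral_succ_le {Ω : Type*} {mΩ : MeasurableSpace Ω} {P : Measure Ω}
    [IsFiniteMeasure P] {T : ℕ} {F : Filtration (Fin (T + 1)) mΩ} {X : Fin (T + 1) → Ω → ℝ}
    (hX : ∀ t, Measurable[F t] (X t)) (h0 : ∀ t, ∀ᵐ ω ∂P, 0 ≤ X t ω)
    (hint : ∫⁻ ω, ENNReal.ofReal (X 0 ω) ∂P ≠ ∞)
    (hstep : ∀ k : Fin T, ∀ B, MeasurableSet[F k.castSucc] B →
      ∫⁻ ω in B, ENNReal.ofReal (X k.succ ω) ∂P ≤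
        ∫⁻ ω in B, ENNReal.ofReal (X k.castSucc ω) ∂P) :
    Supermartingale X F P := by
  have hle : ∀ j i, i ≤ j → ∀ B, MeasurableSet[F i] B →
      ∫⁻ ω in B, ENNReal.ofReal (X j ω) ∂P ≤ ∫⁻ ω in B, ENNReal.ofReal (X i ω) ∂P := by
    intro j
    induction j using Fin.induction with
    | zero =>
      intro i hi B _
      rw [Fin.le_zero_iff.1 hi]
    | succ k ih =>
      intro i hi B hB
      rcases hi.eq_or_lt with rfl | hlt
      · exact le_rfl
      · have hi' : i ≤ k.castSucc := Fin.le_castSucc_iff.2 hlt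
        exact (hstep k B (F.mono hi' _ hB)).trans (ih i hi' B hB)
  -- Integrability is a consequence of the inequalities, since these are between integrals in ℝ≥0∞
  -- and start from a finite one.
  have hXint : ∀ t, Integrable (X t) P := fun t => by
    refine (lintegral_ofReal_ne_top_iff_integrable
      ((hX t).mono (F.le t) le_rfl).aestronglyMeasurable (h0 t)).1 ?_
    have := hle t 0 (Fin.zero_le t) Set.univ MeasurableSet.univ
    rw [setLIntegral_univ, setLIntegral_univ] at this
    exact (this.trans_lt hint.lt_top).ne
  have hset : ∀ t B, ∫ ω in B, X t ω ∂P = (∫⁻ ω in B, ENNReal.ofReal (X t ω) ∂P).toReal :=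
    fun t B => integral_eq_lintegral_of_nonneg_ae (ae_restrict_of_ae (h0 t))
      (hXint t).aestronglyMeasurable.restrict
  have hadp : StronglyAdapted F X := fun t => (hX t).stronglyMeasurable
  rw [← neg_neg X]
  refine (submartingale_of_setIntegral_le hadp.neg (fun t => (hXint t).neg)
    fun i j hij B hB => ?_).neg
  simp only [Pi.neg_apply, integral_neg, neg_le_neg_iff, hset]
  refine ENNReal.toReal_mono ?_ (hle j i hij B hB)
  exact ((lintegral_ofReal_ne_top_iff_integrable
    (hXint i).aestronglyMeasurable.restrict (ae_restrict_of_ae (h0 i))).2 (hXint i).integrableOn)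

namespace MarketModel

variable {Ω : Type*} [mΩ : MeasurableSpace Ω] {P : Measure Ω} [IsProbabilityMeasure P]
  {T d : ℕ} {M : MarketModel P T d}

/-- Numéraire portfolios of the single periods compose to a numéraire portfolio. -/
lemma isNumeraire_of_forall_period {ρ : Fin T → Ω → EuclideanSpace ℝ (Fin d)} (hρ : M.Allowed ρ)
    (hpos : ∀ k, ∀ᵐ ω ∂P, 0 < 1 + ⟪ρ k ω, M.R k ω⟫_ℝ)
    (hratio : ∀ k, ∀ π ∈ selections (M.F k.castSucc) P (M.Θ k), ∀ A,
      MeasurableSet[M.F k.castSucc] A →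
        ∫⁻ ω in A, ENNReal.ofReal ((1 + ⟪π ω, M.R k ω⟫_ℝ) / (1 + ⟪ρ k ω, M.R k ω⟫_ℝ)) ∂P ≤ P A) :
    M.IsNumeraire ρ := by
  have hwpos : ∀ t, ∀ᵐ ω ∂P, 0 < M.wealth 1 ρ t ω := fun t => by
    filter_upwards [ae_all_iff.2 hpos] with ω h
    exact mul_pos one_pos (Finset.prod_pos fun k _ => h k)
  have hinv : ∀ t, Measurable[M.F t] fun ω => 1 / M.wealth 1 ρ t ω := fun t =>
    measurable_const.div (measurable_wealth hρ 1 t)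
  refine ⟨hρ, hinv, fun t => (hwpos t).mono fun ω h => one_div_pos.2 h,
    .of_forall fun ω => by rw [wealth_zero, div_one], fun π hπ => ?_⟩
  have hX : ∀ t, Measurable[M.F t] fun ω => 1 / M.wealth 1 ρ t ω * M.wealth 1 π t ω := fun t =>
    (hinv t).mul (measurable_wealth hπ 1 t)
  have hX0 : ∀ t, ∀ᵐ ω ∂P, 0 ≤ 1 / M.wealth 1 ρ t ω * M.wealth 1 π t ω := fun t => by
    filter_upwards [hwpos t, nonneg_wealth hπ zero_le_one t] with ω h1 h2
    exact mul_nonneg (one_div_pos.2 h1).le h2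
  refine supermartingale_of_setLIntegral_succ_le hX hX0 ?_ fun k B hB => ?_
  · simp [wealth_zero]
  · have hr : Measurable fun ω =>
        ENNReal.ofReal ((1 + ⟪π k ω, M.R k ω⟫_ℝ) / (1 + ⟪ρ k ω, M.R k ω⟫_ℝ)) :=
      (((measurable_return hπ k).mono (M.F.le _) le_rfl).div
        ((measurable_return hρ k).mono (M.F.le _) le_rfl)).ennreal_ofReal
    -- Over one period V^π/V^ρ is multiplied by the ratio of the gross returns, which `hratio`
    -- controls conditionally; the earlier factor is known at the start of the period.
    refine le_trans (le_of_eq (lintegral_congr_ae (ae_restrict_of_ae ?_)))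
      (setLIntegral_mul_le_of_forall_setLIntegral_le (M.F.le _) hr (hX k.castSucc).ennreal_ofReal
        (hratio k (π k) (hπ k)) hB)
    filter_upwards [hX0 k.castSucc] with ω h1
    rw [← ENNReal.ofReal_mul h1, wealth_succ, wealth_succ]
    congr 1
    rw [one_div, mul_inv, one_div, div_eq_mul_inv]
    ring

/-- Without arbitrage of the first kind there is a numéraire portfolio. -/
theorem NA1.exists_isNumeraire (hNA : M.NA1) : ∃ ρ, M.IsNumeraire ρ := by
  choose ρ hρ hpos hratio using fun k =>
    (hNA.isViable k).exists_numeraire (M.F.le _) (measurable_R k)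
  exact ⟨ρ, isNumeraire_of_forall_period hρ hpos hratio⟩

end MarketModel

end

theorem theorem4p6 {Ω : Type*} [mΩ : MeasurableSpace Ω] (P : Measure Ω) [IsProbabilityMeasure P]
    (T d : ℕ) (M : MarketModel P T d) :
    List.TFAE [M.NA1, M.deflators.Nonempty, ∃ ρ, M.IsNumeraire ρ] := by
  tfae_have 1 → 3 := fun h => h.exists_isNumeraire
  tfae_have 3 → 2 := fun ⟨_, h⟩ => ⟨_, h.2⟩
  tfae_have 2 → 1 := fun ⟨_, h⟩ => MarketModel.IsDeflator.na1 h
  tfae_finish
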